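/- Let $k$ be an infinite field, $m \ge 0$ an integer and $k[x]=k[x_1,\dots,x_m]$. For endomorphisms $\alpha,\beta$ of $k^m$ with matrices $A,B\in k^{m\times m}$ on the canonical basis, let $I_{\alpha,\beta}\subseteq k[x]$ be the ideal generated by all $2$-minors of the $m\times 2$ matrix $[Ax \;\; Bx]$, where $x=(x_1,\dots,x_m)^{T}$, and let $Y_{\alpha,\beta}=\operatorname{Spec}(k[x]/I_{\alpha,\beta})\subseteq \mathbb{A}^m_k$. For a linear subspace $V\subseteq k^m$ let $\overline{V}=\operatorname{Spec}(k[x]/I_V)\subseteq\mathbb{A}^m_k$, where $I_V$ is the vanishing ideal of $V$. Let $U_{\alpha,\beta}$ be the locally closed subscheme $$U_{\alpha,\beta}=Y_{\alpha,\beta}\setminus\bigl(\overline{\ker(\alpha-\beta)}\cup\overline{\ker(\alpha)}\cup\overline{\ker(\beta)}\bigr)$$ of $\mathbb{A}^m_k$. A coordinate projection of $k^m$ is an endomorphism that preserves the values of the coordinates in some set of coordinates and sets the remaining coordinates to zero. Theorem. Let $\pi_1,\pi_2$ be permutations of the $m$ coordinates of $k^m$ and let $\rho_1,\rho_2$ be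 coordinate projections of $k^m$. Then $$\dim U_{\rho_2\rho_1\pi_1,\;\rho_2\pi_2}\;\le\; m-\lfloor \operatorname{rank}(\rho_2)/2\rfloor .$$ (The empty scheme has dimension $-\infty$.) -/

import Mathlib

open AlgebraicGeometry CategoryTheory

noncomputable section

namespace HomomorphicSensing

universe u

/-- A permutation of the `m` coordinates of `k^m`. -/
def IsCoordPermutation {k : Type u} [Field k] {m : ℕ} (π : Module.End k (Fin m → k)) : Prop :=
  ∃ s : Equiv.Perm (Fin m), ∀ (v : Fin m → k) (i : Fin m), π v i = v (s i)

/-- A coordinate projection of `k^m`: it preserves the values of the coordinates in some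
set `S` of coordinates and sets the remaining ones to zero. -/
def IsCoordProjection {k : Type u} [Field k] {m : ℕ} (ρ : Module.End k (Fin m → k)) : Prop :=
  ∃ S : Finset (Fin m), ∀ (v : Fin m → k) (i : Fin m), ρ v i = if i ∈ S then v i else 0

/-- The column `T x` of linear forms, with `T` the matrix of `τ` on the canonical basis of `k^m`
and `x = (x_1, …, x_m)` the column vector of variables. -/
def linearForms {k : Type u} [Field k] {m : ℕ} (τ : Module.End k (Fin m → k)) :
    Fin m → MvPolynomial (Fin m) k :=
  ((LinearMap.toMatrix' τ).map MvPolynomial.C).mulVec MvPolynomial.X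

/-- The `m × 2` matrix `[A x  B x]`, with `A`, `B` the matrices of `α`, `β`. -/
def pairMatrix {k : Type u} [Field k] {m : ℕ} (α β : Module.End k (Fin m → k)) :
    Matrix (Fin m) (Fin 2) (MvPolynomial (Fin m) k) :=
  Matrix.of fun i => ![linearForms α i, linearForms β i]

/-- The ideal `I_{α,β}` of `k[x_1, …, x_m]` generated by all `2`-minors of `[A x  B x]`. -/
def minorIdeal {k : Type u} [Field k] {m : ℕ} (α β : Module.End k (Fin m → k)) :
    Ideal (MvPolynomial (Fin m) k) :=
  Ideal.span {f | ∃ i j : Fin m, i < j ∧ f = ((pairMatrix α β).submatrix ![i, j] id).det}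

/-- Affine space `Spec k[x_1, …, x_m]`. -/
def affineSpace (k : Type u) [Field k] (m : ℕ) : Scheme.{u} :=
  Spec (CommRingCat.of (MvPolynomial (Fin m) k))

/-- The closed subscheme `Spec (k[x] / I)` of affine space. -/
def closedSubscheme {k : Type u} [Field k] {m : ℕ} (I : Ideal (MvPolynomial (Fin m) k)) :
    Scheme.{u} :=
  Spec (CommRingCat.of (MvPolynomial (Fin m) k ⧸ I))

/-- The closed immersion of `Spec (k[x] / I)` into affine space. -/
def closedSubschemeι {k : Type u} [Field k] {m : ℕ} (I : Ideal (MvPolynomial (Fin m) k)) :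
    closedSubscheme I ⟶ affineSpace k m :=
  Spec.map (CommRingCat.ofHom (Ideal.Quotient.mk I))

instance closedSubschemeι_isClosedImmersion {k : Type u} [Field k] {m : ℕ}
    (I : Ideal (MvPolynomial (Fin m) k)) :
    IsClosedImmersion (closedSubschemeι I) :=
  IsClosedImmersion.spec_of_surjective _ Ideal.Quotient.mk_surjective

/-- The set of points of affine space underlying the closed subscheme `Spec (k[x] / I_V)`, where
`I_V` is the vanishing ideal of the linear subspace `V` of `k^m`. -/
def subspaceLocus {k : Type u} [Field k] {m : ℕ} (V : Submodule k (Fin m → k)) :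
    Set (affineSpace k m) :=
  Set.range (closedSubschemeι (MvPolynomial.vanishingIdeal k (V : Set (Fin m → k))))

theorem isClosed_subspaceLocus {k : Type u} [Field k] {m : ℕ} (V : Submodule k (Fin m → k)) :
    IsClosed (subspaceLocus V) :=
  (closedSubschemeι _).isClosedEmbedding.isClosed_range

/-- The closed subscheme `Y_{α,β} = Spec (k[x] / I_{α,β})` of affine space. -/
def schemeY {k : Type u} [Field k] {m : ℕ} (α β : Module.End k (Fin m → k)) : Scheme.{u} :=
  closedSubscheme (minorIdeal α β)

/-- The open part `U_{α,β}` of `Y_{α,β}`: the complement in `Y_{α,β}` of the union of the loci of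
`ker (α - β)`, `ker α` and `ker β`. -/
def opensU {k : Type u} [Field k] {m : ℕ} (α β : Module.End k (Fin m → k)) :
    (schemeY α β).Opens where
  carrier := closedSubschemeι (minorIdeal α β) ⁻¹'
    (subspaceLocus (LinearMap.ker (α - β)) ∪ subspaceLocus (LinearMap.ker α) ∪
      subspaceLocus (LinearMap.ker β))ᶜ
  is_open' := ((((isClosed_subspaceLocus _).union (isClosed_subspaceLocus _)).union
    (isClosed_subspaceLocus _)).isOpen_compl).preimage
      (closedSubschemeι (minorIdeal α β)).continuous

/-- The locally closed subscheme `U_{α,β}` of affine space, as a scheme. -/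
def schemeU {k : Type u} [Field k] {m : ℕ} (α β : Module.End k (Fin m → k)) : Scheme.{u} :=
  (opensU α β).toScheme

end HomomorphicSensing

end

/-!
Write `α = ρ₂ρ₁π₁` and `β = ρ₂π₂`. A point of `U_{α,β}` is a prime `P` of `k[x]`; let `K` be the
fraction field of `k[x]/P` and `ξ_i ∈ K` the image of `x_i`. Since the 2-minors of `[Ax Bx]` vanish
at `ξ`, and since `Aξ`, `Bξ` and `(A - B)ξ` are nonzero (this is where `k` being infinite enters,
`vanishingIdeal_ker_le`), there is `c ∈ K` with `c ≠ 0, 1` and `Aξ = c Bξ`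
(`exists_ratio_of_minors_eq_zero`). For the maps at hand this says: there are a permutation `σ` of
the coordinates and a nonempty set `T` of `rank ρ₂` coordinates such that every `t ∈ T` satisfies
`ξ_t = 0` or `ξ_{σ t} = c ξ_t`.

These relations bound `trdeg K/k` by `m - ⌊#T / 2⌋` (`trdeg_le_of_ratio`).
* If `c` is algebraic over `k`, choose a transcendence basis among the `ξ_i`, indexed by `J`. When
  `t ∈ T ∩ J`, then `ξ_t ≠ 0`, so `ξ_{σ t} = c ξ_t` is different from `ξ_t` and algebraic over
  `k(ξ_t)`; hence `σ t ∉ J`. So `T` is covered by the complement of `J` and its preimage under `σ`,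
  and the complement of `J` has at least `#T / 2` elements.
* If `c` is transcendental, it is not a root of unity, and `K` is algebraic over the field
  generated by `c` and the `ξ_i` with `i ∉ T`: a coordinate outside that field would be multiplied
  by `c` along its whole `σ`-orbit, which forces a power of `c` to be `1`. So
  `trdeg K/k ≤ m - #T + 1`, and `T` is nonempty.

By Noether normalization `dim k[x]/P ≤ trdeg K/k` (`ringKrullDim_le_of_trdeg_le`), and the dimension
of a sober subspace of `Spec k[x]` is at most the supremum of `dim k[x]/P` over its points `P`
(`topologicalKrullDim_le_of_isInducing_primeSpectrum`).
-/

/-! ### Dimension -/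

theorem RingHom.IsIntegral.ringKrullDim_le {R S : Type*} [CommRing R] [CommRing S]
    {f : R →+* S} (hf : f.IsIntegral) : ringKrullDim S ≤ ringKrullDim R := by
  algebraize [f]
  refine Order.krullDim_le_of_strictMono (PrimeSpectrum.comap f) fun p q hpq => ?_
  exact Ideal.IsIntegral.comap_lt_comap (R := R) (I := p.asIdeal) (J := q.asIdeal) hpq

/-- By Noether normalization, a finitely generated domain is integral over a polynomial ring whose
variables stay algebraically independent in any field containing the domain. -/
theorem ringKrullDim_le_of_trdeg_le {k A K : Type*} [Field k] [CommRing A] [IsDomain A]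
    [Algebra k A] [Algebra.FiniteType k A] [Field K] [Algebra k K] (f : A →ₐ[k] K)
    (hf : Function.Injective f) {n : ℕ} (hn : Algebra.trdeg k K ≤ n) : ringKrullDim A ≤ n := by
  obtain ⟨s, g, hg, hint⟩ := exists_integral_inj_algHom_of_fg k A
  have h1 : ringKrullDim A ≤ s := by
    refine (RingHom.IsIntegral.ringKrullDim_le hint).trans ?_
    rw [MvPolynomial.ringKrullDim_of_isNoetherianRing, ringKrullDim_eq_zero_of_field]
    simp
  have h2 := lift_trdeg_le_of_injective (f.comp g) (hf.comp hg)
  rw [MvPolynomial.trdeg_of_isDomain] at h2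
  have h3 : s ≤ n := by
    have := h2.trans (Cardinal.lift_le.mpr hn)
    simpa using this
  exact h1.trans (by exact_mod_cast h3)

/-- A chain of irreducible closed subsets of `X` ending in `W` yields, through generic points, a chain
of primes of `R` above the prime of the generic point of `W`. -/
theorem topologicalKrullDim_le_of_isInducing_primeSpectrum {X R : Type*} [TopologicalSpace X]
    [QuasiSober X] [CommRing R] {f : X → PrimeSpectrum R} (hf : Topology.IsInducing f)
    {n : WithBot ℕ∞} (hn : ∀ x, ringKrullDim (R ⧸ (f x).asIdeal) ≤ n) :
    topologicalKrullDim X ≤ n := by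
  let φ : TopologicalSpace.IrreducibleCloseds X → (PrimeSpectrum R)ᵒᵈ :=
    fun W => OrderDual.toDual (f W.isIrreducible.genericPoint)
  have hgen (W : TopologicalSpace.IrreducibleCloseds X) :
      closure {W.isIrreducible.genericPoint} = (W : Set X) :=
    W.isIrreducible.closure_genericPoint W.isClosed
  have hle (V W : TopologicalSpace.IrreducibleCloseds X) : φ V ≤ φ W ↔ V ≤ W := by
    rw [show φ V ≤ φ W ↔ f W.isIrreducible.genericPoint ≤ f V.isIrreducible.genericPoint
      from Iff.rfl, PrimeSpectrum.le_iff_specializes, hf.specializes_iff,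
      specializes_iff_closure_subset, hgen, hgen]
    rfl
  have hφ : StrictMono φ := fun V W h => by
    rw [lt_iff_le_not_ge] at h ⊢
    rwa [hle, hle]
  rw [topologicalKrullDim, Order.krullDim_eq_iSup_height]
  refine iSup_le fun W => ?_
  refine le_trans ?_ (hn W.isIrreducible.genericPoint)
  rw [ringKrullDim_quotient]
  have h1 := Order.height_le_height_apply_of_strictMono φ hφ W
  have h2 : Order.height (φ W) = Order.coheight (f W.isIrreducible.genericPoint) := rfl
  rw [h2] at h1
  refine (WithBot.coe_le_coe.mpr h1).trans ?_
  rw [Order.coheight_eq_krullDim_Ici]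
  exact le_of_eq rfl

/-! ### Transcendence degree -/

section Trdeg

variable {k K ι : Type*} [Field k] [Field K] [Algebra k K] [Fintype ι]

/-- The case of an algebraic ratio: an index `t ∈ T` and its image `σ t` cannot both index elements
of a transcendence basis consisting of coordinates. -/
theorem trdeg_le_of_isAlgebraic_ratio (σ : Equiv.Perm ι) (T : Finset ι) (ξ : ι → K)
    [Algebra.IsAlgebraic (Algebra.adjoin k (Set.range ξ)) K] {c : K} (hc1 : c ≠ 1)
    (hc : IsAlgebraic k c) (h : ∀ t ∈ T, ξ t = 0 ∨ ξ (σ t) = c * ξ t) :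
    Algebra.trdeg k K ≤ (Fintype.card ι - T.card / 2 : ℕ) := by
  classical
  obtain ⟨B, hB, hbasis⟩ := exists_isTranscendenceBasis_subset (R := k) (Set.range ξ)
  choose f hf using fun b : B => hB b.2
  have hfinj : Function.Injective f := fun a b hab => Subtype.ext <| by rw [← hf a, hab, hf]
  have : Finite B := Finite.of_injective f hfinj
  have := Fintype.ofFinite B
  let J : Finset ι := Finset.univ.image f
  have hJ : J.card = Fintype.card B := Finset.card_image_of_injective _ hfinj
  -- `ξ (σ t) = c * ξ t` makes `ξ (σ t)` algebraic over `k(ξ t)`, and `c ≠ 1` keeps the two apart.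
  have key : ∀ t ∈ T, t ∈ J → σ t ∉ J := by
    intro t ht htJ hstJ
    obtain ⟨a, -, rfl⟩ := Finset.mem_image.mp htJ
    obtain ⟨b, -, hb⟩ := Finset.mem_image.mp hstJ
    have ha0 : (a : K) ≠ 0 := hbasis.1.ne_zero a
    have hba : (b : K) = c * a := by
      rw [← hf a, ← hf b, hb]
      exact (h _ ht).resolve_left (by rwa [hf a])
    have hne : b ∉ ({a} : Set B) := by
      rintro rfl
      exact hc1 (mul_right_cancel₀ ha0 (by rw [← hba, one_mul]))
    refine hbasis.1.transcendental_adjoin hne ?_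
    rw [hba]
    refine IsAlgebraic.mul ?_ ?_
    · exact hc.extendScalars (FaithfulSMul.algebraMap_injective _ _)
    · exact isAlgebraic_algebraMap
        (⟨a, Algebra.subset_adjoin ⟨a, rfl, rfl⟩⟩ :
          Algebra.adjoin k ((fun x : B => (x : K)) '' {a}))
  have hT : T.card ≤ 2 * Jᶜ.card := by
    have hsub : T ⊆ Jᶜ ∪ Jᶜ.image σ.symm := by
      intro t ht
      rw [Finset.mem_union, Finset.mem_image, Finset.mem_compl]
      by_cases htJ : t ∈ J
      · exact Or.inr ⟨σ t, Finset.mem_compl.mpr (key t ht htJ), σ.symm_apply_apply t⟩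
      · exact Or.inl htJ
    have h1 := Finset.card_le_card hsub
    have h2 := Finset.card_union_le Jᶜ (Jᶜ.image σ.symm)
    have h3 := Finset.card_image_le (s := Jᶜ) (f := σ.symm)
    omega
  have hJc := Finset.card_compl J
  have hJle := Finset.card_le_univ J
  rw [← hbasis.cardinalMk_eq_trdeg, Cardinal.mk_fintype]
  exact_mod_cast (by omega : Fintype.card B ≤ Fintype.card ι - T.card / 2)

/-- The case of a ratio that is not a root of unity: `c` and the coordinates outside `T` generate
all coordinates. -/
theorem trdeg_le_of_ratio_pow_ne_one (σ : Equiv.Perm ι) (T : Finset ι) (ξ : ι → K)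
    [Algebra.IsAlgebraic (Algebra.adjoin k (Set.range ξ)) K] {c : K} (hc0 : c ≠ 0)
    (hc : ∀ n : ℕ, 0 < n → c ^ n ≠ 1) (h : ∀ t ∈ T, ξ t = 0 ∨ ξ (σ t) = c * ξ t) :
    Algebra.trdeg k K ≤ (Fintype.card ι - T.card + 1 : ℕ) := by
  classical
  let G : Finset K := insert c (Tᶜ.image ξ)
  let F := IntermediateField.adjoin k (G : Set K)
  have hcF : c ∈ F := IntermediateField.subset_adjoin _ _ (by simp [G])
  -- A coordinate outside `F` is nonzero and has its index in `T`, and then `ξ (σ t) = c * ξ t` is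
  -- outside `F` as well. Going once around the orbit gives `c ^ orderOf σ = 1`.
  have hmem (t : ι) : ξ t ∈ F := by
    by_contra ht
    have hout {i : ι} (hi : ξ i ∉ F) : ξ (σ i) = c * ξ i := by
      have hiT : i ∈ T := by
        by_contra hiT
        exact hi (IntermediateField.subset_adjoin _ _ (Finset.mem_coe.mpr
          (Finset.mem_insert_of_mem (Finset.mem_image_of_mem _ (Finset.mem_compl.mpr hiT)))))
      exact (h i hiT).resolve_left fun h0 => hi (h0 ▸ F.zero_mem)
    have hiter (n : ℕ) : ξ ((σ ^ n) t) = c ^ n * ξ t ∧ ξ ((σ ^ n) t) ∉ F := by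
      induction n with
      | zero => simpa using ht
      | succ n ih =>
        have hs := hout ih.2
        rw [pow_succ', Equiv.Perm.mul_apply]
        refine ⟨by rw [hs, ih.1]; ring, fun hF => ih.2 ?_⟩
        rw [hs] at hF
        have := F.mul_mem (F.inv_mem hcF) hF
        rwa [inv_mul_cancel_left₀ hc0] at this
    have hord := (hiter (orderOf σ)).1
    rw [pow_orderOf_eq_one, Equiv.Perm.one_apply] at hord
    have ht0 : ξ t ≠ 0 := fun h0 => ht (h0 ▸ F.zero_mem)
    exact hc _ (orderOf_pos σ) (mul_right_cancel₀ ht0 (by rw [← hord, one_mul]))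
  have halgF : Algebra.IsAlgebraic F K := by
    have hle : Algebra.adjoin k (Set.range ξ) ≤ F.toSubalgebra :=
      Algebra.adjoin_le (by rintro _ ⟨t, rfl⟩; exact hmem t)
    let := (Subalgebra.inclusion hle).toAlgebra
    have : IsScalarTower (Algebra.adjoin k (Set.range ξ)) F.toSubalgebra K :=
      IsScalarTower.of_algebraMap_eq' rfl
    refine ⟨fun x => ?_⟩
    have hx := Algebra.IsAlgebraic.isAlgebraic (R := Algebra.adjoin k (Set.range ξ)) x
    exact hx.extendScalars (S := F.toSubalgebra) (Subalgebra.inclusion_injective hle)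
  have halg : Algebra.IsAlgebraic (Algebra.adjoin k (G : Set K)) K := by
    refine ⟨fun x => ?_⟩
    exact IntermediateField.isAlgebraic_adjoin_iff.mp (halgF.isAlgebraic x)
  refine (Algebra.IsAlgebraic.trdeg_le_cardinalMk k (G : Set K)).trans ?_
  rw [show Cardinal.mk (G : Set K) = G.card from Cardinal.mk_coe_finset]
  have h1 : G.card ≤ (Tᶜ.image ξ).card + 1 := Finset.card_insert_le _ _
  have h2 := Finset.card_image_le (s := Tᶜ) (f := ξ)
  rw [Finset.card_compl] at h2
  exact_mod_cast h1.trans (by omega)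

/-- A point with `ξ (σ t) = c * ξ t` or `ξ t = 0` for all `t` in the nonempty set `T`,
where `σ` is a permutation and
`c ≠ 0, 1`, generates a field of transcendence degree at most `#ι - ⌊#T / 2⌋`. -/
theorem trdeg_le_of_ratio (σ : Equiv.Perm ι) (T : Finset ι) (hT : T.Nonempty) (ξ : ι → K)
    [Algebra.IsAlgebraic (Algebra.adjoin k (Set.range ξ)) K] {c : K} (hc0 : c ≠ 0) (hc1 : c ≠ 1)
    (h : ∀ t ∈ T, ξ t = 0 ∨ ξ (σ t) = c * ξ t) :
    Algebra.trdeg k K ≤ (Fintype.card ι - T.card / 2 : ℕ) := by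
  by_cases hc : IsAlgebraic k c
  · exact trdeg_le_of_isAlgebraic_ratio σ T ξ hc1 hc h
  · refine (trdeg_le_of_ratio_pow_ne_one (k := k) σ T ξ hc0 ?_ h).trans ?_
    · intro n hn h1
      exact hc (IsAlgebraic.of_pow hn (h1 ▸ isAlgebraic_one))
    · have h1 := hT.card_pos
      have h2 := Finset.card_le_univ T
      exact_mod_cast (by omega : Fintype.card ι - T.card + 1 ≤ Fintype.card ι - T.card / 2)

end Trdeg

namespace HomomorphicSensing

variable {k : Type*} [Field k] {m : ℕ}

/-! ### Linear forms -/

theorem linearForms_apply (τ : Module.End k (Fin m → k)) (i : Fin m) :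
    linearForms τ i =
      ∑ j, MvPolynomial.C (τ (Pi.single j 1) i) * MvPolynomial.X j := by
  simp [linearForms, Matrix.mulVec, dotProduct, LinearMap.toMatrix'_apply]

theorem linearForms_eq_X {τ : Module.End k (Fin m → k)} {i j : Fin m} (h : ∀ v, τ v i = v j) :
    linearForms τ i = MvPolynomial.X j := by
  rw [linearForms_apply, Finset.sum_eq_single j]
  · simp [h]
  · intro l _ hl
    simp [h, hl.symm]
  · simp

theorem linearForms_eq_zero {τ : Module.End k (Fin m → k)} {i : Fin m} (h : ∀ v, τ v i = 0) :
    linearForms τ i = 0 := by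
  simp [linearForms_apply, h]

theorem linearForms_sub (τ υ : Module.End k (Fin m → k)) :
    linearForms (τ - υ) = linearForms τ - linearForms υ := by
  ext1 i
  simp [linearForms_apply, sub_mul]

theorem linearForms_mul (τ υ : Module.End k (Fin m → k)) (i : Fin m) :
    linearForms (τ * υ) i =
      ∑ j, MvPolynomial.C (LinearMap.toMatrix' τ i j) * linearForms υ j := by
  rw [linearForms, LinearMap.toMatrix'_mul, Matrix.map_mul, ← Matrix.mulVec_mulVec]
  simp [Matrix.mulVec, dotProduct, linearForms]

theorem eval_linearForms (τ : Module.End k (Fin m → k)) (v : Fin m → k) (i : Fin m) :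
    MvPolynomial.eval v (linearForms τ i) = τ v i := by
  rw [← LinearMap.toMatrix'_mulVec τ]
  simp [linearForms, Matrix.mulVec, dotProduct]

/-- Over an infinite field the vanishing ideal of the subspace `ker τ` is contained in any ideal that
contains the linear forms `τ x`. -/
theorem vanishingIdeal_ker_le [Infinite k] (τ : Module.End k (Fin m → k))
    {P : Ideal (MvPolynomial (Fin m) k)} (h : ∀ i, linearForms τ i ∈ P) :
    MvPolynomial.vanishingIdeal k (LinearMap.ker τ : Set (Fin m → k)) ≤ P := by
  intro p hp
  obtain ⟨s, hs⟩ := LinearMap.exists_rightInverse_of_surjective τ.rangeRestrict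
    (LinearMap.range_rangeRestrict τ)
  obtain ⟨g, hg⟩ := LinearMap.exists_extend s
  -- `g` is a generalized inverse of `τ`, so `N = 1 - g * τ` maps into `ker τ`, while `N x ≡ x`
  -- modulo the linear forms `τ x`.
  have hreg (v : Fin m → k) : τ (g (τ v)) = τ v := by
    have h1 : g (τ v) = s (τ.rangeRestrict v) := LinearMap.congr_fun hg (τ.rangeRestrict v)
    rw [h1]
    exact congrArg Subtype.val (LinearMap.congr_fun hs (τ.rangeRestrict v))
  let N : Module.End k (Fin m → k) := 1 - g * τ
  have hN0 : MvPolynomial.bind₁ (linearForms N) p = 0 := by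
    refine MvPolynomial.funext fun v => ?_
    have hv : N v ∈ LinearMap.ker τ := by
      simp [N, hreg]
    have h2 : MvPolynomial.eval v (MvPolynomial.bind₁ (linearForms N) p) =
        MvPolynomial.aeval (N v) p := by
      rw [← MvPolynomial.coe_aeval_eq_eval, RingHom.coe_coe, MvPolynomial.aeval_bind₁]
      congr 2
      ext1 i
      exact eval_linearForms N v i
    rw [h2, map_zero]
    exact hp _ hv
  have hmod (i : Fin m) : Ideal.Quotient.mk P (linearForms N i) =
      Ideal.Quotient.mk P (MvPolynomial.X i) := by
    rw [Ideal.Quotient.eq, linearForms_sub, Pi.sub_apply,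
      linearForms_eq_X (τ := 1) (i := i) (j := i) (fun _ => rfl), sub_sub_cancel_left]
    rw [linearForms_mul]
    exact P.neg_mem (P.sum_mem fun j _ => P.mul_mem_left _ (h j))
  rw [← Ideal.Quotient.eq_zero_iff_mem, ← map_zero (Ideal.Quotient.mk P), ← hN0]
  have hhom : (Ideal.Quotient.mkₐ k P) =
      (Ideal.Quotient.mkₐ k P).comp (MvPolynomial.bind₁ (linearForms N)) := by
    ext i
    simpa using (hmod i).symm
  exact DFunLike.congr_fun hhom p

/-! ### Points of `U_{α,β}` as prime ideals -/

theorem range_closedSubschemeι (I : Ideal (MvPolynomial (Fin m) k)) :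
    Set.range (closedSubschemeι I) =
      (PrimeSpectrum.zeroLocus (I : Set (MvPolynomial (Fin m) k)) :
        Set (PrimeSpectrum (MvPolynomial (Fin m) k))) := by
  have h := range_comap_of_surjective _ (Ideal.Quotient.mk I)
    Ideal.Quotient.mk_surjective
  rw [Ideal.mk_ker] at h
  exact h

/-- A point of affine space outside the locus of `ker τ` does not annihilate the column `τ x`. -/
theorem exists_linearForms_notMem [Infinite k] {τ : Module.End k (Fin m → k)}
    {x : PrimeSpectrum (MvPolynomial (Fin m) k)}
    (hx : x ∉ (subspaceLocus (LinearMap.ker τ) : Set (PrimeSpectrum _))) :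
    ∃ i, linearForms τ i ∉ x.asIdeal := by
  by_contra! h
  refine hx ?_
  rw [subspaceLocus, range_closedSubschemeι]
  exact vanishingIdeal_ker_le τ h

/-- The inclusion of `U_{α,β}` into affine space on underlying points, which are regarded as prime
ideals of `k[x_1, …, x_m]`. -/
noncomputable def pointU (α β : Module.End k (Fin m → k)) (u : schemeU α β) :
    PrimeSpectrum (MvPolynomial (Fin m) k) :=
  closedSubschemeι (minorIdeal α β) ((opensU α β).ι u)

theorem isInducing_pointU (α β : Module.End k (Fin m → k)) :
    Topology.IsInducing (pointU α β) :=
  (closedSubschemeι (minorIdeal α β)).isClosedEmbedding.isInducing.comp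
    (opensU α β).ι.isOpenEmbedding.isInducing

theorem minorIdeal_le_pointU (α β : Module.End k (Fin m → k)) (u : schemeU α β) :
    minorIdeal α β ≤ (pointU α β u).asIdeal := by
  have h : pointU α β u ∈ Set.range (closedSubschemeι (minorIdeal α β)) := ⟨_, rfl⟩
  rw [range_closedSubschemeι] at h
  exact h

theorem pointU_notMem (α β : Module.End k (Fin m → k)) (u : schemeU α β) :
    pointU α β u ∉ (subspaceLocus (LinearMap.ker (α - β)) ∪ subspaceLocus (LinearMap.ker α) ∪
      subspaceLocus (LinearMap.ker β) : Set (affineSpace k m)) :=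
  u.2

theorem minor_mem {α β : Module.End k (Fin m → k)} (i j : Fin m) :
    linearForms α i * linearForms β j - linearForms α j * linearForms β i ∈ minorIdeal α β := by
  have hlt {i j : Fin m} (hij : i < j) :
      linearForms α i * linearForms β j - linearForms α j * linearForms β i ∈ minorIdeal α β := by
    refine Ideal.subset_span ⟨i, j, hij, ?_⟩
    rw [Matrix.det_fin_two]
    change _ = linearForms α i * linearForms β j - linearForms β i * linearForms α j
    ring
  rcases lt_trichotomy i j with h | rfl | h
  · exact hlt h
  · simp
  · rw [← neg_sub]
    exact neg_mem (hlt h)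

/-! ### The ratio of the two columns and the dimension at a point -/

theorem exists_ratio_of_minors_eq_zero {K ι : Type*} [Field K] {a b : ι → K}
    (hminor : ∀ i j, a i * b j = a j * b i) (hab : a ≠ b) (ha : a ≠ 0) (hb : b ≠ 0) :
    ∃ c : K, c ≠ 0 ∧ c ≠ 1 ∧ ∀ i, a i = c * b i := by
  obtain ⟨j, hj⟩ := Function.ne_iff.mp hb
  have h (i : ι) : a i = a j / b j * b i := by
    have : b j ≠ 0 := hj
    field_simp
    exact hminor i j
  refine ⟨a j / b j, ?_, ?_, h⟩
  · intro h0
    exact ha (funext fun i => by rw [h i, h0, zero_mul, Pi.zero_apply])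
  · intro h1
    exact hab (funext fun i => by rw [h i, h1, one_mul])

theorem finrank_range_le_card {ρ : Module.End k (Fin m → k)} {S : Finset (Fin m)}
    (hρ : ∀ (v : Fin m → k) (i : Fin m), ρ v i = if i ∈ S then v i else 0) :
    Module.finrank k (LinearMap.range ρ) ≤ S.card := by
  let f : (Fin m → k) →ₗ[k] (S → k) := LinearMap.funLeft k k Subtype.val
  have hf : Function.Injective (f ∘ₗ (LinearMap.range ρ).subtype) := by
    rw [← LinearMap.ker_eq_bot, LinearMap.ker_eq_bot']
    rintro ⟨_, v, rfl⟩ hv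
    ext i
    by_cases hi : i ∈ S
    · exact congrFun hv ⟨i, hi⟩
    · simp [hρ, hi]
  simpa using LinearMap.finrank_le_finrank_of_injective hf


theorem isAlgebraic_adjoin_range_of_isFractionRing {k ι A K : Type*} [Field k] [CommRing A]
    [IsDomain A] [Algebra k A] [Field K] [Algebra A K] [Algebra k K] [IsScalarTower k A K]
    [IsFractionRing A K] {x : ι → A} (hx : Algebra.adjoin k (Set.range x) = ⊤) :
    Algebra.IsAlgebraic (Algebra.adjoin k (Set.range fun i => algebraMap A K (x i))) K := by
  let F : A →ₐ[k] K := IsScalarTower.toAlgHom k A K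
  have hmem (y : A) :
      F y ∈ Algebra.adjoin k (Set.range fun i => algebraMap A K (x i)) := by
    have h1 : Set.range (fun i => algebraMap A K (x i)) = F '' Set.range x := by
      rw [← Set.range_comp]
      rfl
    rw [h1, ← AlgHom.map_adjoin, hx]
    exact ⟨y, Algebra.mem_top, rfl⟩
  have : Algebra.IsAlgebraic A K := IsLocalization.isAlgebraic K (nonZeroDivisors A)
  refine ⟨fun z => ?_⟩
  refine (Algebra.IsAlgebraic.isAlgebraic (R := A) z).ringHom_of_comp_eq
    (F.codRestrict _ hmem) (RingHom.id K) ?_ rfl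
  intro a b hab
  exact IsFractionRing.injective A K (congrArg Subtype.val hab)

/-- The dimension bound for the closure of a single point `P` of `U_{α,β}`: the residue field of `P`
satisfies the hypotheses of `trdeg_le_of_ratio`. -/
theorem ringKrullDim_quotient_le {k : Type*} [Field k] {m : ℕ}
    {π₁ π₂ ρ₁ ρ₂ : Module.End k (Fin m → k)}
    (hπ₁ : IsCoordPermutation π₁) (hπ₂ : IsCoordPermutation π₂)
    (hρ₁ : IsCoordProjection ρ₁) (hρ₂ : IsCoordProjection ρ₂)
    {α β : Module.End k (Fin m → k)} (hα : α = ρ₂ ∘ₗ ρ₁ ∘ₗ π₁) (hβ : β = ρ₂ ∘ₗ π₂)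
    (P : Ideal (MvPolynomial (Fin m) k)) [P.IsPrime] (hP : minorIdeal α β ≤ P)
    (hPαβ : ∃ i, linearForms (α - β) i ∉ P) (hPα : ∃ i, linearForms α i ∉ P)
    (hPβ : ∃ i, linearForms β i ∉ P) :
    ringKrullDim (MvPolynomial (Fin m) k ⧸ P) ≤
      ((m - Module.finrank k (LinearMap.range ρ₂) / 2 : ℕ) : WithBot ℕ∞) := by
  obtain ⟨s₁, hs₁⟩ := hπ₁
  obtain ⟨s₂, hs₂⟩ := hπ₂
  obtain ⟨S₁, hS₁⟩ := hρ₁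
  obtain ⟨S₂, hS₂⟩ := hρ₂
  let A := MvPolynomial (Fin m) k ⧸ P
  let K := FractionRing A
  let F : A →ₐ[k] K := IsScalarTower.toAlgHom k A K
  have hF : Function.Injective F := IsFractionRing.injective A K
  let φ : MvPolynomial (Fin m) k →ₐ[k] K := F.comp (Ideal.Quotient.mkₐ k P)
  have hφ (p : MvPolynomial (Fin m) k) : φ p = 0 ↔ p ∈ P := by
    rw [← Ideal.Quotient.eq_zero_iff_mem, ← map_eq_zero_iff F hF]
    rfl
  let ξ : Fin m → K := fun i => φ (MvPolynomial.X i)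
  have halg : Algebra.IsAlgebraic (Algebra.adjoin k (Set.range ξ)) K := by
    refine isAlgebraic_adjoin_range_of_isFractionRing
      (x := fun i => Ideal.Quotient.mkₐ k P (MvPolynomial.X i)) ?_
    rw [← (AlgHom.range_eq_top _).mpr (Ideal.Quotient.mkₐ_surjective k P), ← Algebra.map_top,
      ← MvPolynomial.adjoin_range_X, AlgHom.map_adjoin, ← Set.range_comp]
    rfl
  let a : Fin m → K := fun i => φ (linearForms α i)
  let b : Fin m → K := fun i => φ (linearForms β i)
  have ha : a ≠ 0 := by
    obtain ⟨i, hi⟩ := hPα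
    exact Function.ne_iff.mpr ⟨i, fun h0 => hi ((hφ _).mp h0)⟩
  have hb : b ≠ 0 := by
    obtain ⟨i, hi⟩ := hPβ
    exact Function.ne_iff.mpr ⟨i, fun h0 => hi ((hφ _).mp h0)⟩
  have hab : a ≠ b := by
    obtain ⟨i, hi⟩ := hPαβ
    refine Function.ne_iff.mpr ⟨i, fun h0 => hi ((hφ _).mp ?_)⟩
    rw [linearForms_sub, Pi.sub_apply, map_sub, sub_eq_zero]
    exact h0
  have hminor (i j : Fin m) : a i * b j = a j * b i := by
    rw [← sub_eq_zero]
    have := (hφ _).mpr (hP (minor_mem (α := α) (β := β) i j))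
    rwa [map_sub, map_mul, map_mul] at this
  obtain ⟨c, hc0, hc1, hc⟩ := exists_ratio_of_minors_eq_zero hminor hab ha hb
  have hbi {i : Fin m} (hi : i ∈ S₂) : b i = ξ (s₂ i) := by
    refine congrArg φ (linearForms_eq_X fun v => ?_)
    simp [hβ, hS₂, hi, hs₂]
  have hai {i : Fin m} (hi : i ∈ S₂) : a i = ξ (s₁ i) ∨ a i = 0 := by
    by_cases hi' : i ∈ S₁
    · refine Or.inl (congrArg φ (linearForms_eq_X fun v => ?_))
      simp [hα, hS₂, hi, hS₁, hi', hs₁]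
    · refine Or.inr ((congrArg φ (linearForms_eq_zero fun v => ?_)).trans (map_zero φ))
      simp [hα, hS₂, hi, hS₁, hi']
  have hne : S₂.Nonempty := by
    obtain ⟨i, hi⟩ := Function.ne_iff.mp hb
    refine ⟨i, by_contra fun hi' => hi ?_⟩
    refine (congrArg φ (linearForms_eq_zero fun v => ?_)).trans (map_zero φ)
    simp [hβ, hS₂, hi']
  have htr : Algebra.trdeg k K ≤
      (Fintype.card (Fin m) - (S₂.map s₂.toEmbedding).card / 2 : ℕ) := by
    -- Row `i ∈ S₂` reads `b i = ξ (s₂ i)` and `a i = ξ (s₁ i)` or `a i = 0`, so for `t = s₂ i` the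
    -- relation `a i = c * b i` connects `t` with `s₁ (s₂⁻¹ t)`.
    refine trdeg_le_of_ratio (s₂.symm.trans s₁) (S₂.map s₂.toEmbedding) (hne.map) ξ hc0 hc1 ?_
    intro t ht
    obtain ⟨i, hi, rfl⟩ := Finset.mem_map.mp ht
    have h1 := hc i
    rw [hbi hi] at h1
    simp only [Equiv.coe_toEmbedding, Equiv.trans_apply, Equiv.symm_apply_apply]
    rcases hai hi with h2 | h2
    · exact Or.inr (h2 ▸ h1)
    · rw [h2] at h1
      exact Or.inl ((mul_eq_zero.mp h1.symm).resolve_left hc0)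
  have hr := finrank_range_le_card hS₂
  refine (ringKrullDim_le_of_trdeg_le F hF htr).trans ?_
  rw [Finset.card_map, Fintype.card_fin]
  exact_mod_cast (by omega :
    m - S₂.card / 2 ≤ m - Module.finrank k (LinearMap.range ρ₂) / 2)

theorem ringKrullDim_quotient_pointU_le {k : Type*} [Field k] [Infinite k] {m : ℕ}
    {π₁ π₂ ρ₁ ρ₂ : Module.End k (Fin m → k)}
    (hπ₁ : IsCoordPermutation π₁) (hπ₂ : IsCoordPermutation π₂)
    (hρ₁ : IsCoordProjection ρ₁) (hρ₂ : IsCoordProjection ρ₂)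
    (u : schemeU (ρ₂ ∘ₗ ρ₁ ∘ₗ π₁) (ρ₂ ∘ₗ π₂)) :
    ringKrullDim (MvPolynomial (Fin m) k ⧸ (pointU _ _ u).asIdeal) ≤
      ((m - Module.finrank k (LinearMap.range ρ₂) / 2 : ℕ) : WithBot ℕ∞) := by
  have hu := pointU_notMem _ _ u
  exact ringKrullDim_quotient_le hπ₁ hπ₂ hρ₁ hρ₂ rfl rfl _ (minorIdeal_le_pointU _ _ u)
    (exists_linearForms_notMem fun h => hu (Or.inl (Or.inl h)))
    (exists_linearForms_notMem fun h => hu (Or.inl (Or.inr h)))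
    (exists_linearForms_notMem fun h => hu (Or.inr h))

end HomomorphicSensing

theorem theorem2 {k : Type*} [Field k] [Infinite k] (m : ℕ)
    (π₁ π₂ ρ₁ ρ₂ : Module.End k (Fin m → k))
    (hπ₁ : HomomorphicSensing.IsCoordPermutation π₁)
    (hπ₂ : HomomorphicSensing.IsCoordPermutation π₂)
    (hρ₁ : HomomorphicSensing.IsCoordProjection ρ₁)
    (hρ₂ : HomomorphicSensing.IsCoordProjection ρ₂) :
    topologicalKrullDim (HomomorphicSensing.schemeU (ρ₂ ∘ₗ ρ₁ ∘ₗ π₁) (ρ₂ ∘ₗ π₂)) ≤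
      ((m - Module.finrank k (LinearMap.range ρ₂) / 2 : ℕ) : WithBot ℕ∞) :=
  topologicalKrullDim_le_of_isInducing_primeSpectrum
    (HomomorphicSensing.isInducing_pointU _ _)
    (HomomorphicSensing.ringKrullDim_quotient_pointU_le hπ₁ hπ₂ hρ₁ hρ₂)
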